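/- Let $\Delta\subset\mathbb R^2$ be the closed equilateral triangle of side $1$ with vertices $(0,0)$, $(1,0)$ and $(\tfrac12,\tfrac{\sqrt3}{2})$. For a sequence $\vec q=(q_j)_{j\ge 0}$ of integers $q_j\ge 1$, let $E_0=\Delta$ and, for $j\ge 0$, let $E_{j+1}$ be obtained from $E_j$ by dividing the sides of each of the triangles forming $E_j$ into $q_j$ equal parts, so that the triangle is cut into $q_j^2$ equal equilateral triangles, and keeping only the $q_j(q_j+1)/2$ (closed) upward pointing ones. The modified Sierpinski gasket is $S(\vec q)=\bigcap_{j\ge 0}E_j$, with the Euclidean distance; if $q_j=q$ for all $j$ it is the $q$-Sierpinski triangle $S(q)$. Its extreme points are the extreme points of its convex hull, i.e. the three vertices of $\Delta$. For pointed metric spaces $(X,x)$, $(Y,y)$, let $d_{pGH}((X,x),(Y,y))$ be the infimum of the $\varepsilon>0$ for which there is a metric $d$ on the disjoint union of $X$ and $Y$, extending the given metrics, such that $d(x,y)<\varepsilon$, every point of the closed ball $\overline B_X(x,1/\varepsilon)$ is at $d$-distance less than $\varepsilon$ from some point of $Y$, and every point of $\overline B_Y(y,1/\varepsilon)$ is at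 $d$-distance less than $\varepsilon$ from some point of $X$. A tangent set of a metric space $(X,d)$ at $x\in X$ is a proper pointed metric space $T$ that is a limit point of $(X,x,t\,d)$ as $t\to\infty$ in the pointed Gromov-Hausdorff topology: for every $\varepsilon>0$ there are arbitrarily large $t$ with $d_{pGH}(T,(X,x,t\,d))<\varepsilon$. The tangent cone $\mathcal T_xX$ is the family of all tangent sets of $X$ at $x$. **Theorem.** Let $q\ge 2$ be an integer, and suppose that $\vec q$ contains arbitrarily long runs of the value $q$: for every $p\in\mathbb N$ there is $\overline{\jmath}$ such that $q_j=q$ for all $\overline{\jmath}\le j\le\overline{\jmath}+p$. Then for every extreme point $x$ of $S(\vec q)$ and every extreme point $y$ of $S(q)$, the tangent cone $\mathcal T_yS(q)$ is nonempty and $$\mathcal T_y S(q)\subseteq \mathcal T_x S(\vec q),$$ that is, every tangent set of $S(q)$ at $y$ is a tangent set of $S(\vec q)$ at $x$. -/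

import Mathlib

/-! ### Pointed Gromov-Hausdorff topology and tangent cones -/

/-- A pointed metric space. -/
structure PointedMetricSpace where
  carrier : Type
  [metric : MetricSpace carrier]
  point : carrier

attribute [instance] PointedMetricSpace.metric

namespace PointedMetricSpace

/-- `(X, x, t d)`: the same set and the same base point, with the distance multiplied by `t`. -/
def rescale (X : PointedMetricSpace) (t : ℝ) (ht : 0 < t) : PointedMetricSpace where
  carrier := X.carrier
  metric :=
    { dist := fun a b => t * dist a b
      dist_self := fun a => by simp
      dist_comm := fun a b => by rw [dist_comm]
      dist_triangle := fun a b c => by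
        rw [← mul_add]
        exact mul_le_mul_of_nonneg_left (dist_triangle a b c) ht.le
      eq_of_dist_eq_zero := fun {a b} h => by
        rcases mul_eq_zero.mp h with h | h
        · exact absurd h ht.ne'
        · exact dist_eq_zero.mp h }
  point := X.point

/-- There is a metric `m` on the disjoint union of `X` and `Y`, extending both given metrics, in
which the base points are at distance less than `ε`, the closed ball of radius `1 / ε` about the
base point of `X` lies in the open `ε`-neighbourhood of `Y`, and vice versa. -/
def PGHAdmissible (X Y : PointedMetricSpace) (ε : ℝ) : Prop :=
  ∃ m : MetricSpace (X.carrier ⊕ Y.carrier),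
    (∀ a b : X.carrier, m.dist (Sum.inl a) (Sum.inl b) = dist a b) ∧
    (∀ a b : Y.carrier, m.dist (Sum.inr a) (Sum.inr b) = dist a b) ∧
    m.dist (Sum.inl X.point) (Sum.inr Y.point) < ε ∧
    (∀ a ∈ Metric.closedBall X.point (1 / ε), ∃ b : Y.carrier,
      m.dist (Sum.inl a) (Sum.inr b) < ε) ∧
    (∀ b ∈ Metric.closedBall Y.point (1 / ε), ∃ a : X.carrier,
      m.dist (Sum.inl a) (Sum.inr b) < ε)

/-- The pointed Gromov-Hausdorff distance `d_pGH`. -/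
noncomputable def pghDist (X Y : PointedMetricSpace) : ℝ :=
  sInf {ε : ℝ | 0 < ε ∧ PGHAdmissible X Y ε}

/-- The infimum defining `pghDist` is over a nonempty set. -/
theorem exists_pghAdmissible (X Y : PointedMetricSpace) :
    {ε : ℝ | 0 < ε ∧ PGHAdmissible X Y ε}.Nonempty := by
  let m : MetricSpace (X.carrier ⊕ Y.carrier) := Metric.metricSpaceSum
  let D : ℝ := m.dist (Sum.inl X.point) (Sum.inr Y.point)
  have hD : 0 ≤ D := @dist_nonneg _ m.toPseudoMetricSpace _ _
  have h1 : (1 : ℝ) / (D + 2) ≤ 1 := by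
    rw [div_le_one (by linarith)]; linarith
  refine ⟨D + 2, by linarith, m, fun a b => rfl, fun a b => rfl, ?_, ?_, ?_⟩
  · change D < D + 2
    linarith
  · intro a ha
    refine ⟨Y.point, ?_⟩
    have h2 : m.dist (Sum.inl a) (Sum.inl X.point) = dist a X.point := rfl
    have h3 : m.dist (Sum.inl a) (Sum.inr Y.point) ≤
        m.dist (Sum.inl a) (Sum.inl X.point) + D := m.dist_triangle _ _ _
    have h4 : dist a X.point ≤ 1 / (D + 2) := ha
    linarith
  · intro b hb
    refine ⟨X.point, ?_⟩
    have h2 : m.dist (Sum.inr Y.point) (Sum.inr b) = dist Y.point b := rfl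
    have h3 : m.dist (Sum.inl X.point) (Sum.inr b) ≤
        D + m.dist (Sum.inr Y.point) (Sum.inr b) := m.dist_triangle _ _ _
    have h4 : dist b Y.point ≤ 1 / (D + 2) := hb
    rw [dist_comm] at h4
    linarith

/-- The tangent cone of `X` at its base point: the family of its tangent sets, i.e. of all proper
pointed metric spaces `T` that are limit points of `(X, x, t d)` for `t → ∞` in the pointed
Gromov-Hausdorff topology, in which the sets `{Y | pghDist T Y < ε}` form a neighbourhood base
at `T`. -/
def tangentCone (X : PointedMetricSpace) : Set PointedMetricSpace :=
  {T | ProperSpace T.carrier ∧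
    ∀ ε : ℝ, 0 < ε → ∀ M : ℝ, ∃ t : ℝ, ∃ ht : 0 < t, M < t ∧ pghDist T (X.rescale t ht) < ε}

end PointedMetricSpace

/-! ### Modified Sierpinski gaskets -/

namespace Gasket

/-- The third vertex of the equilateral triangle with vertices `0`, `1` and `apex`. -/
noncomputable def apex : ℂ := ⟨1 / 2, Real.sqrt 3 / 2⟩

/-- The closed (solid) equilateral triangle with vertices `0`, `1` and `apex`. -/
noncomputable def triangle : Set ℂ := convexHull ℝ {0, 1, apex}

/-- The side length of the triangles present after `n` steps: the inverse of the product of the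
first `n` terms of `q`. -/
noncomputable def side (q : ℕ → ℕ) (n : ℕ) : ℝ := (∏ i ∈ Finset.range n, (q i : ℝ))⁻¹

/-- The lower left vertices of the triangles present after `n` steps. In the next step every such
triangle, with lower left vertex `c`, is divided into `(q n) ^ 2` equal triangles, of which the
`q n * (q n + 1) / 2` upward pointing ones are kept; their lower left vertices are
`c + s * (a + b * apex)` with `a + b < q n`, where `s` is the new side length. -/
noncomputable def corners (q : ℕ → ℕ) : ℕ → Set ℂ
  | 0 => {0}
  | n + 1 => {z | ∃ c ∈ corners q n, ∃ a b : ℕ, a + b < q n ∧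
      z = c + (side q (n + 1) : ℂ) * ((a : ℂ) + (b : ℂ) * apex)}

/-- The union of the closed triangles present after `n` steps. -/
noncomputable def level (q : ℕ → ℕ) (n : ℕ) : Set ℂ :=
  {z | ∃ c ∈ corners q n, ∃ w ∈ triangle, z = c + (side q n : ℂ) * w}

end Gasket

/-- The modified Sierpinski gasket `S(q)` of a sequence `q` of natural numbers. -/
noncomputable def gasket (q : ℕ → ℕ) : Set ℂ := ⋂ n : ℕ, Gasket.level q n

/-- `S(q)` with the Euclidean distance of the plane and a base point `x`. -/
noncomputable def pointedGasket (q : ℕ → ℕ) (x : gasket q) : PointedMetricSpace where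
  carrier := gasket q
  point := x

/-!
At its corner `0`, the gasket `S(q)` looks, at the scale `side q n`, like the gasket of the shifted
sequence `i ↦ q (n + i)`: the two have the same corners there (`exists_of_mem_corners_add`). If the
shifted sequence starts with `m` terms equal to `q₀`, its corners after `m` steps are those of
`S(q₀)`, and these corners are `side`-dense in either gasket. Hence `t • S(q₀)` and
`(t / side q n) • S(q)` are, up to an error `t * q₀ ^ (-m)`, the same set in a ball about `0` of
radius comparable with `t` (`approxIsometric_gasket`). If now `T` is a tangent set of `S(q₀)` and is
close to `t • S(q₀)` for some large `t`, a run of the value `q₀` that is long in terms of `t` begins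
at some `n`, and `T` is close to `(t / side q n) • S(q)`, where `t / side q n ≥ t` is again large.
No control on the terms of `q` outside the runs is needed, since `t` may be multiplied by any factor
at least `1`.

The tangent cone of `S(q₀)` at `0` is nonempty because it contains the closure of the union of the
sets `q₀ ^ k • S(q₀)`, a closed subset of the plane and hence a proper space
(`pointedBlowup_mem_tangentCone`).

The other extreme points reduce to `0`: the convex hull of `S(q)` is the triangle, so its extreme
points are the three vertices, and the rotation by `2π / 3` about the centre preserves `S(q)` and
permutes them (`tangentCone_eq_of_mem_extremePoints`).

Pointed Gromov-Hausdorff closeness is handled through correspondences (`ApproxIsometric`), which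
agree with metrics on the disjoint union up to an arbitrarily small loss in `ε`, and which compose.
-/

namespace PointedMetricSpace

/-! ### Correspondences and the pointed Gromov-Hausdorff distance -/

/-- `X` and `Y` are close at scale `ε` as witnessed by a correspondence rather than by a metric on
`X ⊕ Y`: a relation that relates the base points, distorts distances by at most `2 * ε`, and whose
domain and codomain contain the closed balls of radius `1 / ε` about the base points. -/
def ApproxIsometric (X Y : PointedMetricSpace) (ε : ℝ) : Prop :=
  ∃ R : X.carrier → Y.carrier → Prop, R X.point Y.point ∧
    (∀ a b a' b', R a b → R a' b' → |dist a a' - dist b b'| ≤ 2 * ε) ∧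
    (∀ a ∈ Metric.closedBall X.point (1 / ε), ∃ b, R a b) ∧
    (∀ b ∈ Metric.closedBall Y.point (1 / ε), ∃ a, R a b)

theorem ApproxIsometric.mono {X Y : PointedMetricSpace} {ε ε' : ℝ} (h : ApproxIsometric X Y ε)
    (hε : 0 < ε) (hle : ε ≤ ε') : ApproxIsometric X Y ε' := by
  obtain ⟨R, h0, h1, h2, h3⟩ := h
  have hinv : 1 / ε' ≤ 1 / ε := one_div_le_one_div_of_le hε hle
  exact ⟨R, h0, fun a b a' b' hab hab' => (h1 a b a' b' hab hab').trans (by linarith),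
    fun a ha => h2 a (Metric.closedBall_subset_closedBall hinv ha),
    fun b hb => h3 b (Metric.closedBall_subset_closedBall hinv hb)⟩

theorem PGHAdmissible.approxIsometric {X Y : PointedMetricSpace} {ε : ℝ}
    (h : PGHAdmissible X Y ε) : ApproxIsometric X Y ε := by
  obtain ⟨m, hX, hY, h0, h1, h2⟩ := h
  refine ⟨fun a b => m.dist (Sum.inl a) (Sum.inr b) < ε, h0, ?_, h1, h2⟩
  intro a b a' b' hab hab'
  rw [← hX, ← hY, abs_le]
  have t1 := m.dist_triangle (Sum.inl a) (Sum.inr b) (Sum.inl a')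
  have t2 := m.dist_triangle (Sum.inr b) (Sum.inr b') (Sum.inl a')
  have t3 := m.dist_triangle (Sum.inr b) (Sum.inl a) (Sum.inr b')
  have t4 := m.dist_triangle (Sum.inl a) (Sum.inl a') (Sum.inr b')
  have c1 := m.dist_comm (Sum.inr b) (Sum.inl a)
  have c2 := m.dist_comm (Sum.inr b') (Sum.inl a')
  constructor <;> linarith

/-- The metric on `X ⊕ Y` is obtained by gluing along the correspondence, with related points
placed at distance exactly `ε`; hence the strict inequality `ε < ε'`. -/
theorem ApproxIsometric.pghAdmissible {X Y : PointedMetricSpace} {ε ε' : ℝ}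
    (h : ApproxIsometric X Y ε) (hε : 0 < ε) (hlt : ε < ε') : PGHAdmissible X Y ε' := by
  obtain ⟨R, h0, h1, h2, h3⟩ := h
  have hinv : 1 / ε' ≤ 1 / ε := one_div_le_one_div_of_le hε hlt.le
  let Z := {p : X.carrier × Y.carrier // R p.1 p.2}
  let Φ : Z → X.carrier := fun p => p.1.1
  let Ψ : Z → Y.carrier := fun p => p.1.2
  have : Nonempty Z := ⟨⟨(X.point, Y.point), h0⟩⟩
  have hdist : ∀ a b, R a b → Metric.glueDist Φ Ψ ε (Sum.inl a) (Sum.inr b) < ε' := by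
    intro a b hab
    rw [Metric.glueDist_glued_points Φ Ψ ε ⟨(a, b), hab⟩]
    exact hlt
  refine ⟨Metric.glueMetricApprox Φ Ψ ε hε fun p p' => h1 _ _ _ _ p.2 p'.2,
    fun _ _ => rfl, fun _ _ => rfl, hdist _ _ h0, fun a ha => ?_, fun b hb => ?_⟩
  · obtain ⟨b, hab⟩ := h2 a (Metric.closedBall_subset_closedBall hinv ha)
    exact ⟨b, hdist _ _ hab⟩
  · obtain ⟨a, hab⟩ := h3 b (Metric.closedBall_subset_closedBall hinv hb)
    exact ⟨a, hdist _ _ hab⟩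

theorem ApproxIsometric.of_pghDist_lt {X Y : PointedMetricSpace} {ε : ℝ}
    (h : pghDist X Y < ε) : ApproxIsometric X Y ε := by
  obtain ⟨δ, ⟨hδ, hadm⟩, hlt⟩ := exists_lt_of_csInf_lt (exists_pghAdmissible X Y) h
  exact hadm.approxIsometric.mono hδ hlt.le

theorem ApproxIsometric.pghDist_lt {X Y : PointedMetricSpace} {ε ε' : ℝ}
    (h : ApproxIsometric X Y ε) (hε : 0 < ε) (hlt : ε < ε') : pghDist X Y < ε' := by
  obtain ⟨δ, h1, h2⟩ := exists_between hlt
  exact lt_of_le_of_lt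
    (csInf_le ⟨0, fun _ h => h.1.le⟩ ⟨hε.trans h1, h.pghAdmissible hε h1⟩) h2

theorem mem_tangentCone_iff {X T : PointedMetricSpace} :
    T ∈ X.tangentCone ↔ ProperSpace T.carrier ∧
      ∀ ε : ℝ, 0 < ε → ∀ M : ℝ, ∃ t : ℝ, ∃ ht : 0 < t, M < t ∧
        ApproxIsometric T (X.rescale t ht) ε := by
  refine and_congr_right fun _ => ⟨fun h ε hε M => ?_, fun h ε hε M => ?_⟩
  · obtain ⟨t, ht, hM, hlt⟩ := h ε hε M
    exact ⟨t, ht, hM, .of_pghDist_lt hlt⟩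
  · obtain ⟨t, ht, hM, happ⟩ := h (ε / 2) (half_pos hε) M
    exact ⟨t, ht, hM, happ.pghDist_lt (half_pos hε) (half_lt_self hε)⟩

/-- The bound `ε ≤ 1 / 2` makes the balls of radius `1 / (2 * ε)` stay, after a distortion by
`2 * ε`, in the balls of radius `1 / ε`. -/
theorem ApproxIsometric.trans {X Y Z : PointedMetricSpace} {ε : ℝ} (h : ApproxIsometric X Y ε)
    (h' : ApproxIsometric Y Z ε) (hε : 0 < ε) (hε' : ε ≤ 1 / 2) :
    ApproxIsometric X Z (2 * ε) := by
  have key : ∀ {X Y Z : PointedMetricSpace}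
      (R : X.carrier → Y.carrier → Prop) (S : Y.carrier → Z.carrier → Prop),
      R X.point Y.point →
      (∀ a b a' b', R a b → R a' b' → |dist a a' - dist b b'| ≤ 2 * ε) →
      (∀ a ∈ Metric.closedBall X.point (1 / ε), ∃ b, R a b) →
      (∀ b ∈ Metric.closedBall Y.point (1 / ε), ∃ c, S b c) →
      ∀ a ∈ Metric.closedBall X.point (1 / (2 * ε)), ∃ c b, R a b ∧ S b c := by
    intro X Y Z R S h0 h1 h2 h3 a ha
    have e : 1 / ε = 2 * (1 / (2 * ε)) := by field_simp
    have hle : 2 * ε ≤ 1 / (2 * ε) := by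
      rw [le_div_iff₀ (by linarith)]; nlinarith
    rw [Metric.mem_closedBall] at ha
    obtain ⟨b, hab⟩ := h2 a (by rw [Metric.mem_closedBall]; linarith)
    have hd := abs_le.1 (h1 _ _ _ _ hab h0)
    obtain ⟨c, hbc⟩ := h3 b (by rw [Metric.mem_closedBall]; linarith [hd.1])
    exact ⟨c, b, hab, hbc⟩
  obtain ⟨R, h0, h1, h2, h3⟩ := h
  obtain ⟨S, k0, k1, k2, k3⟩ := h'
  refine ⟨fun a c => ∃ b, R a b ∧ S b c, ⟨_, h0, k0⟩, ?_, key R S h0 h1 h2 k2, ?_⟩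
  · rintro a c a' c' ⟨b, hab, hbc⟩ ⟨b', hab', hbc'⟩
    have d1 := abs_le.1 (h1 _ _ _ _ hab hab')
    have d2 := abs_le.1 (k1 _ _ _ _ hbc hbc')
    rw [abs_le]
    constructor <;> linarith [d1.1, d1.2, d2.1, d2.2]
  · intro c hc
    obtain ⟨a, b, h1', h2'⟩ := key (fun c b => S b c) (fun b a => R a b) k0
      (fun c b c' b' u v => by rw [abs_sub_comm]; exact k1 _ _ _ _ u v) k3 h3 c hc
    exact ⟨a, b, h2', h1'⟩

/-- Two spaces embedded isometrically in a third one, with the same image of the base points, are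
compared by relating the points whose images are at distance at most `ε`. -/
theorem ApproxIsometric.of_isometry {X Y : PointedMetricSpace} {E : Type*} [PseudoMetricSpace E]
    {f : X.carrier → E} {g : Y.carrier → E} (hf : Isometry f) (hg : Isometry g)
    (h0 : f X.point = g Y.point) {ε : ℝ} (hε : 0 < ε)
    (h1 : ∀ a ∈ Metric.closedBall X.point (1 / ε), ∃ b, dist (f a) (g b) ≤ ε)
    (h2 : ∀ b ∈ Metric.closedBall Y.point (1 / ε), ∃ a, dist (f a) (g b) ≤ ε) :
    ApproxIsometric X Y ε := by
  refine ⟨fun a b => dist (f a) (g b) ≤ ε, ?_, ?_, h1, h2⟩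
  · simpa only [h0, dist_self] using hε.le
  · intro a b a' b' hab hab'
    rw [← hf.dist_eq, ← hg.dist_eq, ← Real.dist_eq]
    exact (dist_dist_dist_le _ _ _ _).trans (by linarith)

theorem ApproxIsometric.trans_isometryEquiv {T X Y : PointedMetricSpace} {ε : ℝ}
    (h : ApproxIsometric T X ε) (e : X.carrier ≃ᵢ Y.carrier) (he : e X.point = Y.point) :
    ApproxIsometric T Y ε := by
  obtain ⟨R, h0, h1, h2, h3⟩ := h
  have he' : e.symm Y.point = X.point := by rw [← he, e.symm_apply_apply]
  refine ⟨fun a b => R a (e.symm b), ?_, fun a b a' b' hab hab' => ?_, fun a ha => ?_,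
    fun b hb => h3 _ ?_⟩
  · simpa only [he'] using h0
  · rw [← e.symm.isometry.dist_eq]
    exact h1 _ _ _ _ hab hab'
  · obtain ⟨b, hab⟩ := h2 a ha
    exact ⟨e b, by simpa only [e.symm_apply_apply] using hab⟩
  · rw [Metric.mem_closedBall, ← he', e.symm.isometry.dist_eq]
    exact hb

/-- An isometry remains one when both distances are multiplied by the same factor. -/
def rescaleIsometryEquiv {X Y : PointedMetricSpace} (e : X.carrier ≃ᵢ Y.carrier) (t : ℝ)
    (ht : 0 < t) : (X.rescale t ht).carrier ≃ᵢ (Y.rescale t ht).carrier where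
  toEquiv := e.toEquiv
  isometry_toFun := Isometry.of_dist_eq fun a b =>
    congrArg (t * ·) (e.isometry.dist_eq (show X.carrier from a) (show X.carrier from b))

theorem tangentCone_eq_of_isometryEquiv {X Y : PointedMetricSpace} (e : X.carrier ≃ᵢ Y.carrier)
    (he : e X.point = Y.point) : X.tangentCone = Y.tangentCone := by
  have key : ∀ {X Y : PointedMetricSpace} (e : X.carrier ≃ᵢ Y.carrier), e X.point = Y.point →
      X.tangentCone ⊆ Y.tangentCone := by
    intro X Y e he T hT
    rw [mem_tangentCone_iff] at hT ⊢
    refine ⟨hT.1, fun ε hε M => ?_⟩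
    obtain ⟨t, ht, hM, h⟩ := hT.2 ε hε M
    exact ⟨t, ht, hM, h.trans_isometryEquiv (rescaleIsometryEquiv e t ht) he⟩
  exact (key e he).antisymm (key e.symm (by rw [← he, e.symm_apply_apply]))

end PointedMetricSpace

namespace Gasket

/-! ### The triangle -/

theorem norm_apex : ‖apex‖ = 1 := by
  have h : ‖apex‖ ^ 2 = 1 := by
    rw [Complex.sq_norm, Complex.normSq_apply]
    simp only [apex]
    nlinarith [Real.mul_self_sqrt (show (0 : ℝ) ≤ 3 by norm_num)]
  exact (pow_eq_one_iff_of_nonneg (norm_nonneg _) two_ne_zero).1 h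

/-- `apex` is a primitive sixth root of unity. -/
theorem apex_sq : apex * apex = apex - 1 := by
  apply Complex.ext
  · simp only [apex, Complex.mul_re, Complex.sub_re, Complex.one_re]
    nlinarith [Real.mul_self_sqrt (show (0 : ℝ) ≤ 3 by norm_num)]
  · simp only [apex, Complex.mul_im, Complex.sub_im, Complex.one_im]
    ring

theorem mem_triangle {z : ℂ} :
    z ∈ triangle ↔ ∃ u v : ℝ, 0 ≤ u ∧ 0 ≤ v ∧ u + v ≤ 1 ∧ z = u + v * apex := by
  constructor
  · intro hz
    let P : Set ℂ := {z | ∃ u v : ℝ, 0 ≤ u ∧ 0 ≤ v ∧ u + v ≤ 1 ∧ z = u + v * apex}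
    have hP : Convex ℝ P := by
      rintro _ ⟨u, v, hu, hv, huv, rfl⟩ _ ⟨u', v', hu', hv', huv', rfl⟩ a b ha hb hab
      refine ⟨a * u + b * u', a * v + b * v', by positivity, by positivity, by nlinarith, ?_⟩
      simp only [Complex.real_smul]
      push_cast
      ring
    have hsub : ({0, 1, apex} : Set ℂ) ⊆ P := by
      rintro _ (rfl | rfl | rfl)
      · exact ⟨0, 0, by norm_num, by norm_num, by norm_num, by simp⟩
      · exact ⟨1, 0, by norm_num, by norm_num, by norm_num, by simp⟩
      · exact ⟨0, 1, by norm_num, by norm_num, by norm_num, by simp⟩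
    exact convexHull_min hsub hP hz
  · rintro ⟨u, v, hu, hv, huv, rfl⟩
    have hc : Convex ℝ triangle := convex_convexHull ℝ _
    have hs : ({0, 1, apex} : Set ℂ) ⊆ triangle := subset_convexHull ℝ _
    have h := hc.sum_mem (t := Finset.univ) (w := ![1 - u - v, u, v]) (z := ![0, 1, apex])
      (by intro i _; fin_cases i <;> simp <;> linarith)
      (by simp [Fin.sum_univ_three]; ring)
      (by intro i _; fin_cases i <;> apply hs <;> simp)
    simpa [Fin.sum_univ_three] using h

theorem zero_mem_triangle : (0 : ℂ) ∈ triangle := subset_convexHull ℝ _ (by simp)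

theorem norm_le_one_of_mem_triangle {z : ℂ} (hz : z ∈ triangle) : ‖z‖ ≤ 1 := by
  obtain ⟨u, v, hu, hv, huv, rfl⟩ := mem_triangle.1 hz
  refine (norm_add_le _ _).trans ?_
  rw [norm_mul, norm_apex, mul_one, Complex.norm_of_nonneg hu, Complex.norm_of_nonneg hv]
  exact huv

/-! ### Side lengths and corners -/

theorem side_pos {q : ℕ → ℕ} (hq : ∀ j, 1 ≤ q j) (n : ℕ) : 0 < side q n :=
  inv_pos.2 (Finset.prod_pos fun i _ => by exact_mod_cast hq i)

theorem side_succ {q : ℕ → ℕ} (hq : ∀ j, 1 ≤ q j) (n : ℕ) :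
    side q n = q n * side q (n + 1) := by
  have h : (q n : ℝ) ≠ 0 := by exact_mod_cast (Nat.one_le_iff_ne_zero.1 (hq n))
  rw [side, side, Finset.prod_range_succ, mul_inv]
  field_simp

theorem side_add (q : ℕ → ℕ) (n m : ℕ) :
    side q (n + m) = side q n * side (fun i => q (n + i)) m := by
  rw [side, side, side, Finset.prod_range_add, mul_inv]

theorem side_le_one {q : ℕ → ℕ} (hq : ∀ j, 1 ≤ q j) (n : ℕ) : side q n ≤ 1 :=
  inv_le_one_of_one_le₀ <| by
    have : 1 ≤ ∏ i ∈ Finset.range n, q i := Finset.one_le_prod' fun i _ => hq i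
    exact_mod_cast this

theorem side_const (q₀ n : ℕ) : side (fun _ => q₀) n = ((q₀ : ℝ) ^ n)⁻¹ := by
  simp [side]

theorem side_congr {q q' : ℕ → ℕ} {n : ℕ} (h : ∀ i < n, q i = q' i) : side q n = side q' n := by
  rw [side, side, Finset.prod_congr rfl fun i hi => by rw [h i (Finset.mem_range.1 hi)]]

theorem corners_congr {q q' : ℕ → ℕ} :
    ∀ {n : ℕ}, (∀ i < n, q i = q' i) → corners q n = corners q' n
  | 0, _ => rfl
  | n + 1, h => by
    rw [corners, corners, corners_congr fun i hi => h i (hi.trans n.lt_succ_self), side_congr h,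
      h n n.lt_succ_self]

/-- The triangles present after `n + m` steps are obtained by carrying out, in each of those
present after `n` steps, the first `m` steps of the construction for the shifted sequence. -/
theorem mem_corners_add {q : ℕ → ℕ} {n m : ℕ} {z : ℂ} :
    z ∈ corners q (n + m) ↔ ∃ c ∈ corners q n, ∃ c' ∈ corners (fun i => q (n + i)) m,
      z = c + side q n * c' := by
  induction m generalizing z with
  | zero => simp [corners]
  | succ m ih =>
    have hs := side_add q n (m + 1)
    rw [← add_assoc] at hs
    constructor
    · rintro ⟨d, hd, a, b, hab, rfl⟩
      obtain ⟨c, hc, c', hc', rfl⟩ := ih.1 hd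
      refine ⟨c, hc, _, ⟨c', hc', a, b, hab, rfl⟩, ?_⟩
      change _ + (side q (n + m + 1) : ℂ) * _ = _
      rw [hs]
      push_cast
      ring
    · rintro ⟨c, hc, _, ⟨c', hc', a, b, hab, rfl⟩, rfl⟩
      refine ⟨_, ih.2 ⟨c, hc, c', hc', rfl⟩, a, b, hab, ?_⟩
      change _ = _ + (side q (n + m + 1) : ℂ) * _
      rw [hs]
      push_cast
      ring

theorem zero_mem_corners {q : ℕ → ℕ} (hq : ∀ j, 1 ≤ q j) : ∀ n, (0 : ℂ) ∈ corners q n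
  | 0 => rfl
  | n + 1 => ⟨0, zero_mem_corners hq n, 0, 0, hq n, by simp⟩

theorem corners_mono {q : ℕ → ℕ} (hq : ∀ j, 1 ≤ q j) {n m : ℕ} (h : n ≤ m) :
    corners q n ⊆ corners q m := by
  obtain ⟨k, rfl⟩ := Nat.exists_eq_add_of_le h
  exact fun c hc => mem_corners_add.2 ⟨c, hc, 0, zero_mem_corners (fun j => hq _) k, by simp⟩

theorem side_mul_mem_corners {q : ℕ → ℕ} (hq : ∀ j, 1 ≤ q j) (n : ℕ) {m : ℕ} {c : ℂ}
    (hc : c ∈ corners (fun i => q (n + i)) m) : (side q n : ℂ) * c ∈ corners q (n + m) :=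
  mem_corners_add.2 ⟨0, zero_mem_corners hq n, c, hc, by simp⟩

/-- The corners lie on the triangular lattice of mesh `side q n`. -/
theorem exists_nat_of_mem_corners {q : ℕ → ℕ} (hq : ∀ j, 1 ≤ q j) :
    ∀ {n : ℕ} {c : ℂ}, c ∈ corners q n → ∃ a b : ℕ, c = side q n * ((a : ℂ) + b * apex)
  | 0, c, hc => ⟨0, 0, by simpa [corners] using hc⟩
  | n + 1, _, ⟨c, hc, a, b, _, rfl⟩ => by
    obtain ⟨a', b', rfl⟩ := exists_nat_of_mem_corners hq hc
    refine ⟨q n * a' + a, q n * b' + b, ?_⟩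
    rw [side_succ hq n]
    push_cast
    ring

theorem re_side_mul {s : ℝ} (a b : ℕ) :
    ((s : ℂ) * ((a : ℂ) + b * apex)).re = s * (a + b / 2) := by
  rw [Complex.re_ofReal_mul]
  simp only [apex, Complex.add_re, Complex.mul_re, Complex.natCast_re, Complex.natCast_im]
  ring

theorem re_nonneg_of_mem_corners {q : ℕ → ℕ} (hq : ∀ j, 1 ≤ q j) {n : ℕ} {c : ℂ}
    (hc : c ∈ corners q n) : 0 ≤ c.re := by
  obtain ⟨a, b, rfl⟩ := exists_nat_of_mem_corners hq hc
  rw [re_side_mul]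
  have := side_pos hq n
  positivity

/-- Near the vertex `0` only the triangle with corner `0` is seen, since every other lattice point
in the cone spanned by `1` and `apex` has real part at least half the mesh. -/
theorem exists_of_mem_corners_add {q : ℕ → ℕ} (hq : ∀ j, 1 ≤ q j) {n m : ℕ} {c : ℂ}
    (hc : c ∈ corners q (n + m)) (hre : c.re < side q n / 2) :
    ∃ c' ∈ corners (fun i => q (n + i)) m, c = side q n * c' := by
  obtain ⟨d, hd, c', hc', rfl⟩ := mem_corners_add.1 hc
  have hs := side_pos hq n
  have h' := re_nonneg_of_mem_corners (fun j => hq (n + j)) hc'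
  obtain ⟨a, b, rfl⟩ := exists_nat_of_mem_corners hq hd
  rw [Complex.add_re, re_side_mul, Complex.re_ofReal_mul] at hre
  have h1 : side q n * (a + b / 2 : ℝ) < side q n * (1 / 2) := by
    have := mul_nonneg hs.le h'
    linarith
  have h2 : (a + b / 2 : ℝ) < 1 / 2 := lt_of_mul_lt_mul_left h1 hs.le
  have h3 : 2 * a + b < 1 := by
    have : (2 * a + b : ℝ) < 1 := by linarith
    exact_mod_cast this
  obtain rfl : a = 0 := by omega
  obtain rfl : b = 0 := by omega
  exact ⟨c', hc', by simp⟩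

/-! ### Density of the corners in the gasket -/

theorem level_zero (q : ℕ → ℕ) : level q 0 = triangle := by
  simp [level, corners, side]

theorem level_succ_subset {q : ℕ → ℕ} (hq : ∀ j, 1 ≤ q j) (n : ℕ) :
    level q (n + 1) ⊆ level q n := by
  rintro _ ⟨_, ⟨c, hc, a, b, hab, rfl⟩, w, hw, rfl⟩
  obtain ⟨u, v, hu, hv, huv, rfl⟩ := mem_triangle.1 hw
  have hpos : (0 : ℝ) < q n := by exact_mod_cast hq n
  have hab' : (a + b + 1 : ℝ) ≤ q n := by exact_mod_cast hab
  refine ⟨c, hc, ((a + u) / q n : ℝ) + ((b + v) / q n : ℝ) * apex,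
    mem_triangle.2 ⟨_, _, by positivity, by positivity, ?_, rfl⟩, ?_⟩
  · rw [← add_div, div_le_one hpos]
    linarith
  · have : (q n : ℂ) ≠ 0 := by exact_mod_cast hpos.ne'
    rw [side_succ hq n]
    push_cast
    field_simp
    ring

theorem corners_subset_gasket {q : ℕ → ℕ} (hq : ∀ j, 1 ≤ q j) (n : ℕ) :
    corners q n ⊆ gasket q := by
  intro c hc
  refine Set.mem_iInter.2 fun m => ?_
  have hanti : Antitone (level q) := antitone_nat_of_succ_le (level_succ_subset hq)
  exact hanti (le_max_right n m)
    ⟨c, corners_mono hq (le_max_left n m) hc, 0, zero_mem_triangle, by simp⟩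

theorem exists_corner_dist_le {q : ℕ → ℕ} (hq : ∀ j, 1 ≤ q j) {z : ℂ} (hz : z ∈ gasket q)
    (n : ℕ) : ∃ c ∈ corners q n, dist z c ≤ side q n := by
  obtain ⟨c, hc, w, hw, rfl⟩ := Set.mem_iInter.1 hz n
  refine ⟨c, hc, ?_⟩
  rw [dist_eq_norm, add_sub_cancel_left, norm_mul, Complex.norm_of_nonneg (side_pos hq n).le]
  exact mul_le_of_le_one_right (side_pos hq n).le (norm_le_one_of_mem_triangle hw)

theorem zero_mem_gasket {q : ℕ → ℕ} (hq : ∀ j, 1 ≤ q j) : (0 : ℂ) ∈ gasket q :=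
  corners_subset_gasket hq 0 rfl

theorem gasket_subset_triangle (q : ℕ → ℕ) : gasket q ⊆ triangle := by
  rw [← level_zero q]
  exact Set.iInter_subset _ 0

/-! ### Rotational symmetry and the extreme points -/

/-- The rotation of the plane by `2π / 3` about the centre of the triangle, which permutes the
vertices cyclically: `0 ↦ 1 ↦ apex ↦ 0`. -/
noncomputable def rotation (z : ℂ) : ℂ := 1 + (apex - 1) * z

theorem rotation_rotation_rotation (z : ℂ) : rotation (rotation (rotation z)) = z := by
  have h : apex * apex = apex - 1 := apex_sq
  have h3 : (apex - 1) * (apex - 1) * (apex - 1) = 1 := by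
    linear_combination (apex - 2) * h
  simp only [rotation]
  linear_combination z * h3 + h

theorem isometry_rotation : Isometry rotation := by
  refine Isometry.of_dist_eq fun z w => ?_
  have h : ‖apex - 1‖ = 1 := by rw [← apex_sq, norm_mul, norm_apex, mul_one]
  rw [dist_eq_norm, dist_eq_norm, rotation, rotation, add_sub_add_left_eq_sub, ← mul_sub, norm_mul,
    h, one_mul]

theorem rotation_mem_triangle {z : ℂ} (hz : z ∈ triangle) : rotation z ∈ triangle := by
  obtain ⟨u, v, hu, hv, huv, rfl⟩ := mem_triangle.1 hz
  refine mem_triangle.2 ⟨1 - u - v, u, by linarith, hu, by linarith, ?_⟩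
  rw [rotation]
  push_cast
  linear_combination (v : ℂ) * apex_sq

/-- The image under the rotation of the triangle with corner `c` has the corner
`1 - side q n + (apex - 1) * c`, the image of its top vertex `c + side q n * apex`. -/
theorem rotation_corner {q : ℕ → ℕ} (hq : ∀ j, 1 ≤ q j) :
    ∀ {n : ℕ} {c : ℂ}, c ∈ corners q n → 1 - (side q n : ℂ) + (apex - 1) * c ∈ corners q n
  | 0, c, hc => by
    rw [show c = 0 from hc]
    simp [corners, side]
  | n + 1, _, ⟨c, hc, a, b, hab, rfl⟩ => by
    refine ⟨_, rotation_corner hq hc, q n - 1 - a - b, a, by omega, ?_⟩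
    obtain ⟨k, hk⟩ := Nat.exists_eq_add_of_lt hab
    rw [show q n - 1 - a - b = k by omega, side_succ hq n, hk]
    push_cast
    linear_combination (side q (n + 1) : ℂ) * b * apex_sq

theorem rotation_mem_gasket {q : ℕ → ℕ} (hq : ∀ j, 1 ≤ q j) {z : ℂ} (hz : z ∈ gasket q) :
    rotation z ∈ gasket q := by
  refine Set.mem_iInter.2 fun n => ?_
  obtain ⟨c, hc, w, hw, rfl⟩ := Set.mem_iInter.1 hz n
  refine ⟨_, rotation_corner hq hc, _, rotation_mem_triangle hw, ?_⟩
  simp only [rotation]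
  ring

/-- The rotation as an isometry of the gasket. -/
noncomputable def gasketRotation {q : ℕ → ℕ} (hq : ∀ j, 1 ≤ q j) : gasket q ≃ᵢ gasket q :=
  IsometryEquiv.mk' (fun z => ⟨rotation z, rotation_mem_gasket hq z.2⟩)
    (fun z => ⟨rotation (rotation z), rotation_mem_gasket hq (rotation_mem_gasket hq z.2)⟩)
    (fun z => Subtype.ext (rotation_rotation_rotation z))
    (Isometry.of_dist_eq fun z w => isometry_rotation.dist_eq z w)

theorem eq_vertex_of_mem_extremePoints {q : ℕ → ℕ} (hq : ∀ j, 1 ≤ q j) {x : ℂ}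
    (hx : x ∈ (convexHull ℝ (gasket q)).extremePoints ℝ) : x = 0 ∨ x = 1 ∨ x = apex := by
  have h0 := zero_mem_gasket hq
  have h1 : (1 : ℂ) ∈ gasket q := by simpa [rotation] using rotation_mem_gasket hq h0
  have h2 : apex ∈ gasket q := by simpa [rotation] using rotation_mem_gasket hq h1
  have hsub : ({0, 1, apex} : Set ℂ) ⊆ gasket q := by
    rintro _ (rfl | rfl | rfl) <;> assumption
  have heq : convexHull ℝ (gasket q) = triangle :=
    (convexHull_min (gasket_subset_triangle q) (convex_convexHull ℝ _)).antisymm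
      (convexHull_mono hsub)
  rw [heq] at hx
  have hmem : x ∈ ({0, 1, apex} : Set ℂ) := extremePoints_convexHull_subset hx
  simpa using hmem

/-- By symmetry, the tangent cone is the same at all extreme points. -/
theorem tangentCone_eq_of_mem_extremePoints {q : ℕ → ℕ} (hq : ∀ j, 1 ≤ q j) (x : gasket q)
    (hx : (x : ℂ) ∈ (convexHull ℝ (gasket q)).extremePoints ℝ) :
    (pointedGasket q x).tangentCone =
      (pointedGasket q ⟨0, zero_mem_gasket hq⟩).tangentCone := by
  have hrot : ∀ z w : gasket q, rotation z = w →
      (pointedGasket q z).tangentCone = (pointedGasket q w).tangentCone := fun z w h =>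
    PointedMetricSpace.tangentCone_eq_of_isometryEquiv (X := pointedGasket q z)
      (Y := pointedGasket q w) (gasketRotation hq) (Subtype.ext h)
  have hapex : ∀ z : gasket q, (z : ℂ) = apex → (pointedGasket q z).tangentCone =
      (pointedGasket q ⟨0, zero_mem_gasket hq⟩).tangentCone := fun z h =>
    hrot z _ (by
      simp only [rotation, h]
      linear_combination apex_sq)
  rcases eq_vertex_of_mem_extremePoints hq hx with h | h | h
  · rw [show x = ⟨0, zero_mem_gasket hq⟩ from Subtype.ext h]
  · have hr : rotation x = apex := by simp [rotation, h]
    rw [hrot x ⟨rotation x, rotation_mem_gasket hq x.2⟩ rfl]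
    exact hapex _ hr
  · exact hapex x h

end Gasket

namespace Gasket

/-! ### Tangent sets at the vertex `0` -/

theorem isometry_mul_gasket (q : ℕ → ℕ) (x : gasket q) {t : ℝ} (ht : 0 < t) :
    Isometry (fun a : ((pointedGasket q x).rescale t ht).carrier =>
      (t : ℂ) * ((show gasket q from a) : ℂ)) := by
  refine Isometry.of_dist_eq fun a b => ?_
  change _ = t * dist ((show gasket q from a) : ℂ) ((show gasket q from b) : ℂ)
  rw [dist_eq_norm, dist_eq_norm, ← mul_sub, norm_mul, Complex.norm_of_nonneg ht.le]

theorem norm_le_of_mem_closedBall {q : ℕ → ℕ} (hq : ∀ j, 1 ≤ q j) {t : ℝ} (ht : 0 < t) {r : ℝ}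
    {b : ((pointedGasket q ⟨0, zero_mem_gasket hq⟩).rescale t ht).carrier}
    (hb : b ∈ Metric.closedBall
      ((pointedGasket q ⟨0, zero_mem_gasket hq⟩).rescale t ht).point r) :
    t * ‖((show gasket q from b) : ℂ)‖ ≤ r := by
  have h : t * dist ((show gasket q from b) : ℂ) 0 ≤ r := hb
  rwa [dist_zero_right] at h

/-- If the terms of `q` with indices `n, …, n + m - 1` are the first `m` terms of `q'`, then
`S(q)` scaled by `t / side q n` and `S(q')` scaled by `t` have, away from the far side of the
triangle of side `t`, the same corners of mesh `t * side q' m`. -/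
theorem approxIsometric_gasket {q q' : ℕ → ℕ} (hq : ∀ j, 1 ≤ q j) (hq' : ∀ j, 1 ≤ q' j)
    {n m : ℕ} (heq : ∀ i < m, q (n + i) = q' i) {t ε : ℝ} (ht : 0 < t)
    (ht' : 0 < t / side q n) (hε : 0 < ε) (hmesh : t * side q' m ≤ ε)
    (hball : 1 / ε + ε < t / 2) :
    PointedMetricSpace.ApproxIsometric
      ((pointedGasket q' ⟨0, zero_mem_gasket hq'⟩).rescale t ht)
      ((pointedGasket q ⟨0, zero_mem_gasket hq⟩).rescale (t / side q n) ht') ε := by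
  have hs := side_pos hq n
  have hsC : (side q n : ℂ) ≠ 0 := by exact_mod_cast hs.ne'
  have hcor : corners (fun i => q (n + i)) m = corners q' m := corners_congr heq
  have hside : side q (n + m) = side q n * side q' m := by rw [side_add, side_congr heq]
  refine .of_isometry (isometry_mul_gasket q' _ ht) (isometry_mul_gasket q _ ht') ?_ hε ?_ ?_
  · change (t : ℂ) * 0 = ((t / side q n : ℝ) : ℂ) * 0
    rw [mul_zero, mul_zero]
  · rintro ⟨a, ha⟩ _
    obtain ⟨c, hc, hac⟩ := exists_corner_dist_le hq' ha m
    have hc' : (side q n : ℂ) * c ∈ gasket q :=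
      corners_subset_gasket hq _ (side_mul_mem_corners hq n (hcor ▸ hc))
    refine ⟨⟨_, hc'⟩, ?_⟩
    change dist ((t : ℂ) * a) (((t / side q n : ℝ) : ℂ) * (side q n * c)) ≤ ε
    have e : ((t / side q n : ℝ) : ℂ) * (side q n * c) = t * c := by
      push_cast
      field_simp
    rw [e, dist_eq_norm, ← mul_sub, norm_mul, Complex.norm_of_nonneg ht.le, ← dist_eq_norm]
    exact (mul_le_mul_of_nonneg_left hac ht.le).trans hmesh
  · intro b hb
    -- A point of the ball has a corner near it whose real part is less than half of `side q n`, so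
    -- this corner belongs to the triangle of step `n` at `0`, where `S(q)` is a copy of `S(q')`.
    have hbn := norm_le_of_mem_closedBall hq ht' hb
    obtain ⟨b, hbq⟩ := b
    change t / side q n * ‖b‖ ≤ 1 / ε at hbn
    obtain ⟨c, hc, hbc⟩ := exists_corner_dist_le hq hbq (n + m)
    have hclose : t / side q n * ‖b - c‖ ≤ ε := by
      rw [← dist_eq_norm]
      refine le_trans (mul_le_mul_of_nonneg_left hbc ht'.le) (le_trans (le_of_eq ?_) hmesh)
      rw [hside]
      field_simp
    have hre : c.re < side q n / 2 := by
      have h1 : ‖c‖ ≤ ‖b‖ + ‖b - c‖ := by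
        have := norm_sub_le b (b - c)
        rwa [sub_sub_cancel] at this
      have h2 : t / side q n * ‖c‖ < t / side q n * (side q n / 2) := by
        have e : t / side q n * (side q n / 2) = t / 2 := by field_simp
        rw [e]
        have := mul_le_mul_of_nonneg_left h1 ht'.le
        linarith
      exact (Complex.re_le_norm c).trans_lt (lt_of_mul_lt_mul_left h2 ht'.le)
    obtain ⟨c', hc', rfl⟩ := exists_of_mem_corners_add hq hc hre
    refine ⟨⟨c', corners_subset_gasket hq' m (hcor ▸ hc')⟩, ?_⟩
    change dist ((t : ℂ) * c') (((t / side q n : ℝ) : ℂ) * b) ≤ ε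
    have e : (t : ℂ) * c' = ((t / side q n : ℝ) : ℂ) * (side q n * c') := by
      push_cast
      field_simp
    rw [e, dist_comm, dist_eq_norm, ← mul_sub, norm_mul, Complex.norm_of_nonneg ht'.le]
    exact hclose

theorem exists_mul_side_const_le {q₀ : ℕ} (hq₀ : 2 ≤ q₀) (t : ℝ) {ε : ℝ} (hε : 0 < ε) :
    ∃ m, t * side (fun _ => q₀) m ≤ ε := by
  have hq₁ : (1 : ℝ) < q₀ := by exact_mod_cast hq₀
  obtain ⟨m, hm⟩ := pow_unbounded_of_one_lt (t / ε) hq₁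
  refine ⟨m, ?_⟩
  rw [div_lt_iff₀ hε] at hm
  rw [side_const, ← div_eq_mul_inv, div_le_iff₀ (by positivity)]
  linarith

/-- The unbounded self-similar set obtained from `S(q₀)` by blowing up at the vertex `0`, as the
closure of the union of the dilates by `q₀ ^ k` of the corners. -/
noncomputable def blowup (q₀ : ℕ) : Set ℂ :=
  closure {z | ∃ k n : ℕ, ∃ c ∈ corners (fun _ => q₀) n, z = (q₀ : ℂ) ^ k * c}

theorem zero_mem_blowup (q₀ : ℕ) : (0 : ℂ) ∈ blowup q₀ :=
  subset_closure ⟨0, 0, 0, rfl, by simp⟩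

/-- The blow-up with the distance of the plane and the base point `0`. -/
noncomputable def pointedBlowup (q₀ : ℕ) : PointedMetricSpace where
  carrier := blowup q₀
  point := ⟨0, zero_mem_blowup q₀⟩

/-- Within distance `q₀ ^ k / 2` of `0`, the dilated corners that define the blow-up already lie
in `q₀ ^ k • S(q₀)`. -/
theorem exists_mem_gasket_of_re_lt {q₀ : ℕ} (hq₀ : 2 ≤ q₀) {k l n : ℕ} {c : ℂ}
    (hc : c ∈ corners (fun _ => q₀) n) (hre : ((q₀ : ℂ) ^ l * c).re < (q₀ : ℝ) ^ k / 2) :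
    ∃ b ∈ gasket (fun _ => q₀), (q₀ : ℂ) ^ l * c = (q₀ : ℂ) ^ k * b := by
  have hq : ∀ j : ℕ, 1 ≤ (fun _ : ℕ => q₀) j := fun _ => one_le_two.trans hq₀
  have hpos : (0 : ℝ) < q₀ := by exact_mod_cast (by omega : 0 < q₀)
  have hne : (q₀ : ℂ) ≠ 0 := by exact_mod_cast hpos.ne'
  rcases le_total l k with h | h
  · obtain ⟨d, rfl⟩ := Nat.exists_eq_add_of_le h
    refine ⟨_, corners_subset_gasket hq _ (side_mul_mem_corners hq d hc), ?_⟩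
    rw [side_const]
    push_cast
    field_simp
    ring
  · obtain ⟨d, rfl⟩ := Nat.exists_eq_add_of_le h
    have hre' : c.re < side (fun _ => q₀) d / 2 := by
      have e : ((q₀ : ℂ) ^ (k + d) * c).re = (q₀ : ℝ) ^ (k + d) * c.re := by
        rw [← Complex.re_ofReal_mul]
        push_cast
        rfl
      rw [e] at hre
      have h2 : (q₀ : ℝ) ^ k / 2 = (q₀ : ℝ) ^ (k + d) * (side (fun _ => q₀) d / 2) := by
        rw [side_const]
        field_simp
        ring
      rw [h2] at hre
      exact lt_of_mul_lt_mul_left hre (by positivity)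
    obtain ⟨c', hc', rfl⟩ :=
      exists_of_mem_corners_add hq (corners_mono hq (Nat.le_add_left n d) hc) hre'
    refine ⟨c', corners_subset_gasket hq _ hc', ?_⟩
    rw [side_const]
    push_cast
    field_simp
    ring

theorem pointedBlowup_mem_tangentCone {q₀ : ℕ} (hq₀ : 2 ≤ q₀) (hq : ∀ _ : ℕ, 1 ≤ q₀) :
    pointedBlowup q₀ ∈
      (pointedGasket (fun _ => q₀) ⟨0, zero_mem_gasket hq⟩).tangentCone := by
  refine PointedMetricSpace.mem_tangentCone_iff.2
    ⟨ProperSpace.of_isClosed isClosed_closure, fun ε hε M => ?_⟩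
  have hq₁ : (1 : ℝ) < q₀ := by exact_mod_cast hq₀
  obtain ⟨k, hk⟩ := pow_unbounded_of_one_lt (max M (2 * (1 / ε + ε))) hq₁
  have ht : (0 : ℝ) < (q₀ : ℝ) ^ k := by positivity
  -- The blow-up is invariant under multiplication by `q₀`, so the scales `q₀ ^ k` all serve.
  refine ⟨(q₀ : ℝ) ^ k, ht, (le_max_left _ _).trans_lt hk, ?_⟩
  have hk' : 1 / ε + ε < (q₀ : ℝ) ^ k / 2 := by linarith [(le_max_right _ _).trans_lt hk]
  refine .of_isometry (f := fun a : (pointedBlowup q₀).carrier => ((show blowup q₀ from a) : ℂ))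
    isometry_subtype_coe (isometry_mul_gasket _ _ ht) ?_ hε ?_ ?_
  · change (0 : ℂ) = (((q₀ : ℝ) ^ k : ℝ) : ℂ) * 0
    rw [mul_zero]
  · rintro ⟨a, ha⟩ hball
    have hnorm : ‖a‖ ≤ 1 / ε := by
      have h : dist a 0 ≤ 1 / ε := hball
      rwa [dist_zero_right] at h
    obtain ⟨_, ⟨l, n, c, hc, rfl⟩, hd⟩ := Metric.mem_closure_iff.1 ha ε hε
    obtain ⟨b, hb, he⟩ := exists_mem_gasket_of_re_lt (k := k) (l := l) hq₀ hc (by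
      refine (Complex.re_le_norm _).trans_lt ?_
      have := norm_sub_le a (a - (q₀ : ℂ) ^ l * c)
      rw [sub_sub_cancel, ← dist_eq_norm] at this
      linarith)
    refine ⟨⟨b, hb⟩, ?_⟩
    change dist a ((((q₀ : ℝ) ^ k : ℝ) : ℂ) * b) ≤ ε
    push_cast
    rw [← he]
    exact hd.le
  · rintro ⟨b, hb⟩ _
    obtain ⟨m, hm⟩ := exists_mul_side_const_le hq₀ ((q₀ : ℝ) ^ k) hε
    obtain ⟨c, hc, hbc⟩ := exists_corner_dist_le hq hb m
    refine ⟨⟨(q₀ : ℂ) ^ k * c, subset_closure ⟨k, m, c, hc, rfl⟩⟩, ?_⟩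
    change dist ((q₀ : ℂ) ^ k * c) ((((q₀ : ℝ) ^ k : ℝ) : ℂ) * b) ≤ ε
    have e : (q₀ : ℂ) ^ k = (((q₀ : ℝ) ^ k : ℝ) : ℂ) := by push_cast; rfl
    rw [e, dist_comm, dist_eq_norm, ← mul_sub, norm_mul, Complex.norm_of_nonneg ht.le,
      ← dist_eq_norm]
    exact (mul_le_mul_of_nonneg_left hbc ht.le).trans hm

end Gasket

open PointedMetricSpace Gasket in
theorem mainTheorem6 (q : ℕ → ℕ) (hq : ∀ j, 1 ≤ q j) (q₀ : ℕ) (hq₀ : 2 ≤ q₀)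
    (hrun : ∀ p : ℕ, ∃ j₀ : ℕ, ∀ j, j₀ ≤ j → j ≤ j₀ + p → q j = q₀)
    (x : gasket q) (hx : (x : ℂ) ∈ (convexHull ℝ (gasket q)).extremePoints ℝ)
    (y : gasket (fun _ => q₀))
    (hy : (y : ℂ) ∈ (convexHull ℝ (gasket (fun _ => q₀))).extremePoints ℝ) :
    (pointedGasket (fun _ => q₀) y).tangentCone.Nonempty ∧
      (pointedGasket (fun _ => q₀) y).tangentCone ⊆ (pointedGasket q x).tangentCone := by
  have hqc : ∀ _ : ℕ, 1 ≤ q₀ := fun _ => by omega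
  rw [tangentCone_eq_of_mem_extremePoints hq x hx,
    tangentCone_eq_of_mem_extremePoints hqc y hy]
  refine ⟨⟨_, pointedBlowup_mem_tangentCone hq₀ hqc⟩, fun T hT => ?_⟩
  rw [mem_tangentCone_iff] at hT ⊢
  refine ⟨hT.1, fun ε hε M => ?_⟩
  obtain ⟨δ, hδ, hδ', hδε⟩ : ∃ δ : ℝ, 0 < δ ∧ δ ≤ 1 / 2 ∧ 2 * δ ≤ ε :=
    ⟨min (1 / 2) (ε / 2), by positivity, min_le_left _ _,
      by linarith [min_le_right (1 / 2 : ℝ) (ε / 2)]⟩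
  obtain ⟨t, ht, htM, hTt⟩ := hT.2 δ hδ (max M (2 * (1 / δ + δ)))
  -- With `t` fixed, the run of the value `q₀` only has to be long enough for the triangles of
  -- `t • S(q₀)` to reach size `δ` within it.
  obtain ⟨p, hp⟩ := exists_mul_side_const_le hq₀ t hδ
  obtain ⟨j₀, hj₀⟩ := hrun p
  have ht' : 0 < t / side q j₀ := div_pos ht (side_pos hq j₀)
  have hle : t ≤ t / side q j₀ := le_div_self ht.le (side_pos hq j₀) (side_le_one hq j₀)
  refine ⟨t / side q j₀, ht', ((le_max_left _ _).trans_lt htM).trans_le hle, ?_⟩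
  have hcmp := approxIsometric_gasket hq hqc (n := j₀) (m := p)
    (fun i hi => hj₀ _ (by omega) (by omega)) ht ht' hδ hp
    (by linarith [(le_max_right _ _).trans_lt htM])
  exact (hTt.trans hcmp hδ hδ').mono (by linarith) hδε
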